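/- Let $(\Omega,\mathcal F,P)$ be a complete probability space carrying a standard real Brownian motion $(W_t)_{t\ge 0}$, with natural filtration $(\mathcal F_t)$ augmented by the null sets and made right-continuous. Let $\Theta\subset\mathbb R$ be compact and convex, and let $\mathcal A^\Theta$ be the set of $(\mathcal F_t)$-progressively measurable processes $\theta:[0,\infty)\times\Omega\to\Theta$ with $E_P\int_0^T|\theta_s|^2ds<\infty$ for all $T>0$. For $\theta\in\mathcal A^\Theta$ put $B^\theta_t=\int_0^t\theta_s\,dW_s$ (Itô integral). Fix $T\ge 0$ and $p\in[1,\infty)$. Let $\Omega_T$ be the space of continuous paths $w:[0,T]\to\mathbb R$ with $w(0)=0$, with canonical process $B_t(w)=w(t)$. A cylinder function is a function $\xi=\varphi(B_{t_1},\dots,B_{t_n})$ on $\Omega_T$ with $t_1,\dots,t_n\in[0,T]$ and $\varphi\in C_{l.Lip}(\mathbb R^n)$, i.e. $|\varphi(x)-\varphi(y)|\le C(1+|x|^m+|y|^m)|x-y|$ for some $C\ge0$ and $m\in\mathbb N$ depending on $\varphi$. For such $\xi$ and $\theta\in\mathcal A^\Theta$ let $\xi^\theta=\varphi(B^\theta_{t_1},\dots,B^\theta_{t_n})$,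 and let the $G$-expectation be $\hat E[\xi]=\sup_{\theta\in\mathcal A^\Theta}E_P[\xi^\theta]$. Let $L^p_G(\Omega_T)$ be the completion of the space of cylinder functions under $\|\xi\|_{L^p_G}=\hat E[|\xi|^p]^{1/p}$. For $X\in L^p_G(\Omega_T)$ let $\Phi(X)=\{X^\theta\}_{\theta\in\mathcal A^\Theta}$ be the family in $L^p(P)$ characterized by $$\sup_{\theta\in\mathcal A^\Theta}\|X^\theta-\xi_n^\theta\|_{L^p(P)}\to 0\quad\text{for every sequence of cylinder functions }\xi_n\text{ with }\|X-\xi_n\|_{L^p_G}\to 0 .$$ Then for all $X,Y\in L^p_G(\Omega_T)$, $$\Phi(X+Y)=\Phi(X)+\Phi(Y),$$ that is, $(X+Y)^\theta=X^\theta+Y^\theta$ in $L^p(P)$ for every $\theta\in\mathcal A^\Theta$. -/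

import Mathlib

open MeasureTheory ProbabilityTheory Filter Topology
open scoped NNReal ENNReal

noncomputable section

namespace GHom

section Basic

variable {Ω : Type*} [m : MeasurableSpace Ω] {P : Measure Ω} [P.IsComplete]
  {W : ℝ≥0 → Ω → ℝ}

theorem measurable_brownian (hW : IsBrownianReal W P) (t : ℝ≥0) : Measurable (W t) :=
  aemeasurable_iff_measurable.1 (hW.toIsPreBrownianReal.aemeasurable t)

/-- The σ-algebra generated by the `P`-null sets. -/
@[reducible]
def nullSigma (P : Measure Ω) : MeasurableSpace Ω :=
  MeasurableSpace.generateFrom {N | P N = 0}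

theorem nullSigma_le : nullSigma P ≤ m :=
  MeasurableSpace.generateFrom_le fun _ hN => measurableSet_of_null hN

/-- The natural filtration of the Brownian motion `W`, augmented by the `P`-null sets and made
right-continuous (so that it satisfies the usual conditions). -/
def filt (hW : IsBrownianReal W P) : Filtration ℝ≥0 m :=
  (Filtration.natural W (fun t => (measurable_brownian hW t).stronglyMeasurable) ⊔
    Filtration.const ℝ≥0 (nullSigma P) nullSigma_le).rightCont

/-- The set `𝒜^Θ` of admissible controls: the progressively measurable processes with values in
`Θ` such that `E ∫₀ᵀ |θ_s|² ds < ∞` for every `T`. -/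
def admissible (hW : IsBrownianReal W P) (Θ : Set ℝ) : Set (ℝ≥0 → Ω → ℝ) :=
  {θ | (∀ t ω, θ t ω ∈ Θ) ∧ IsProgressive (filt hW) θ ∧
    ∀ T : ℝ≥0, ∫⁻ ω, (∫⁻ s in Set.Icc (0 : ℝ) T, ‖θ s.toNNReal ω‖ₑ ^ 2) ∂P < ∞}

/-- A simple process `∑_{k < n} h_k 1_{(τ_k, τ_{k+1}]}`, where `h_k` is bounded and
`F_{τ_k}`-measurable and the `τ_k` are nondecreasing deterministic times. -/
structure SimpleProc (hW : IsBrownianReal W P) where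
  n : ℕ
  τ : ℕ → ℝ≥0
  mono : Monotone τ
  h : ℕ → Ω → ℝ
  meas : ∀ k, Measurable[filt hW (τ k)] (h k)
  bdd : ∀ k, ∃ C : ℝ, ∀ ω, |h k ω| ≤ C

/-- The process itself. -/
def SimpleProc.val {hW : IsBrownianReal W P} (H : SimpleProc hW) (s : ℝ≥0) (ω : Ω) : ℝ :=
  ∑ k ∈ Finset.range H.n, (Set.Ioc (H.τ k) (H.τ (k + 1))).indicator (fun _ => H.h k ω) s

/-- `∫₀ᵗ H dW = ∑_k h_k (W_{τ_{k+1} ∧ t} - W_{τ_k ∧ t})` for a simple process `H`. -/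
def SimpleProc.integral {hW : IsBrownianReal W P} (H : SimpleProc hW) (t : ℝ≥0) (ω : Ω) : ℝ :=
  ∑ k ∈ Finset.range H.n, H.h k ω * (W (min (H.τ (k + 1)) t) ω - W (min (H.τ k) t) ω)

/-- `I` is the Itô integral `∫₀ᵗ θ dW`: it is the limit in `L²(P)` of the integrals of simple
processes `H_n` such that `E ∫₀ᵗ |H_n - θ|² ds → 0`. -/
def IsItoIntegral (hW : IsBrownianReal W P) (θ : ℝ≥0 → Ω → ℝ) (t : ℝ≥0) (I : Lp ℝ 2 P) : Prop :=
  ∃ H : ℕ → SimpleProc hW,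
    Tendsto (fun n => ∫⁻ ω, (∫⁻ s in Set.Icc (0 : ℝ) t,
      ‖(H n).val s.toNNReal ω - θ s.toNNReal ω‖ₑ ^ 2) ∂P) atTop (𝓝 0) ∧
    Tendsto (fun n => eLpNorm (fun ω => (H n).integral t ω - I ω) 2 P) atTop (𝓝 0)

open Classical in
/-- The controlled process `B_t^θ = ∫₀ᵗ θ_s dW_s`. For an admissible control with values in a
bounded set the Itô integral exists and is unique, so the second branch is not taken. -/
def ctrl (hW : IsBrownianReal W P) (θ : ℝ≥0 → Ω → ℝ) (t : ℝ≥0) : Lp ℝ 2 P :=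
  if h : ∃ I, IsItoIntegral hW θ t I then h.choose else 0

theorem ctrl_zero (hW : IsBrownianReal W P) (θ : ℝ≥0 → Ω → ℝ) :
    ∀ᵐ ω ∂P, (ctrl hW θ 0 : Ω → ℝ) ω = 0 := by
  unfold ctrl
  split_ifs with h
  · obtain ⟨H, -, hI⟩ := h.choose_spec
    have h0 : ∀ n, (fun ω => (H n).integral 0 ω - h.choose ω) = fun ω => - h.choose ω := by
      intro n; funext ω; simp [SimpleProc.integral]
    simp only [h0] at hI
    have h1 := tendsto_nhds_unique hI tendsto_const_nhds
    have h2 : eLpNorm (h.choose : Ω → ℝ) 2 P = 0 := by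
      rw [← eLpNorm_neg]; exact h1.symm
    exact (eLpNorm_eq_zero_iff (Lp.aestronglyMeasurable _) (by norm_num)).1 h2
  · exact Lp.coeFn_zero ℝ 2 P

end Basic

section Cylinder

/-- The path space `Ω_T = C₀([0,T])` of continuous paths that start at `0`; the canonical process
is `B_t(w) = w t`. -/
abbrev PathSpace (T : ℝ≥0) : Type := {w : C(Set.Iic T, ℝ) // w ⟨0, Set.mem_Iic.2 zero_le⟩ = 0}

/-- The class `C_{l.Lip}(ℝⁿ)` of locally Lipschitz functions:
`|φ x - φ y| ≤ C (1 + |x|^m + |y|^m) |x - y|` for some `C` and `m` depending on `φ`. (The norm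
on `Fin n → ℝ` is the maximum norm, which defines the same class as the Euclidean one.) -/
def LocLip {n : ℕ} (φ : (Fin n → ℝ) → ℝ) : Prop :=
  ∃ (C : ℝ) (k : ℕ), ∀ x y, |φ x - φ y| ≤ C * (1 + ‖x‖ ^ k + ‖y‖ ^ k) * ‖x - y‖

/-- `X = φ(B_{t_1}, …, B_{t_n})` on the path space. -/
def IsRep {T : ℝ≥0} (X : PathSpace T → ℝ) (n : ℕ) (t : Fin n → Set.Iic T)
    (φ : (Fin n → ℝ) → ℝ) : Prop :=
  LocLip φ ∧ ∀ w : PathSpace T, X w = φ (fun i => w.1 (t i))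

/-- `X` is a cylinder function. The times need not be listed in increasing order. -/
def IsCylinder {T : ℝ≥0} (X : PathSpace T → ℝ) : Prop :=
  ∃ n t φ, IsRep X n t φ

theorem LocLip.exists_pos {n : ℕ} {φ : (Fin n → ℝ) → ℝ} (h : LocLip φ) :
    ∃ (C : ℝ) (k : ℕ), 0 ≤ C ∧ ∀ x y, |φ x - φ y| ≤ C * (1 + ‖x‖ + ‖y‖) ^ k * ‖x - y‖ := by
  obtain ⟨C, k, hC⟩ := h
  refine ⟨|C| * 3, k, by positivity, fun x y => (hC x y).trans ?_⟩
  have hx : ‖x‖ ^ k ≤ (1 + ‖x‖ + ‖y‖) ^ k :=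
    pow_le_pow_left₀ (norm_nonneg _) (by linarith [norm_nonneg x, norm_nonneg y]) k
  have hy : ‖y‖ ^ k ≤ (1 + ‖x‖ + ‖y‖) ^ k :=
    pow_le_pow_left₀ (norm_nonneg _) (by linarith [norm_nonneg x, norm_nonneg y]) k
  have h1 : 1 ≤ (1 + ‖x‖ + ‖y‖) ^ k :=
    one_le_pow₀ (by linarith [norm_nonneg x, norm_nonneg y])
  gcongr ?_ * _
  calc C * (1 + ‖x‖ ^ k + ‖y‖ ^ k) ≤ |C| * (1 + ‖x‖ ^ k + ‖y‖ ^ k) := by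
        gcongr; exact le_abs_self C
    _ ≤ |C| * (3 * (1 + ‖x‖ + ‖y‖) ^ k) := by gcongr; linarith
    _ = _ := by ring

theorem LocLip.of_pow {n : ℕ} {φ : (Fin n → ℝ) → ℝ} (C : ℝ) (k : ℕ) (hC : 0 ≤ C)
    (h : ∀ x y, |φ x - φ y| ≤ C * (1 + ‖x‖ + ‖y‖) ^ k * ‖x - y‖) : LocLip φ := by
  refine ⟨C * 3 ^ k, k, fun x y => (h x y).trans ?_⟩
  gcongr ?_ * _
  rw [mul_assoc]
  gcongr
  have hx := norm_nonneg x
  have hy := norm_nonneg y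
  set a := ‖x‖
  set b := ‖y‖
  have hM : 1 + a + b ≤ 3 * max 1 (max a b) := by
    have h1 := le_max_left 1 (max a b)
    have h2 := (le_max_left a b).trans (le_max_right 1 (max a b))
    have h3 := (le_max_right a b).trans (le_max_right 1 (max a b))
    linarith
  have hMk : (max 1 (max a b)) ^ k ≤ 1 + a ^ k + b ^ k := by
    have ha := pow_nonneg hx k
    have hb := pow_nonneg hy k
    rcases max_choice 1 (max a b) with h | h
    · rw [h, one_pow]; linarith
    · rw [h]
      rcases max_choice a b with h | h <;> rw [h] <;> linarith
  calc (1 + a + b) ^ k ≤ (3 * max 1 (max a b)) ^ k := by gcongr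
    _ = 3 ^ k * (max 1 (max a b)) ^ k := by rw [mul_pow]
    _ ≤ _ := by gcongr

theorem LocLip.continuous {n : ℕ} {φ : (Fin n → ℝ) → ℝ} (h : LocLip φ) : Continuous φ := by
  obtain ⟨C, k, hC⟩ := h
  rw [continuous_iff_continuousAt]
  intro y
  rw [ContinuousAt, tendsto_iff_dist_tendsto_zero]
  have h0 : Tendsto (fun x => C * (1 + ‖x‖ ^ k + ‖y‖ ^ k) * ‖x - y‖) (𝓝 y)
      (𝓝 (C * (1 + ‖y‖ ^ k + ‖y‖ ^ k) * ‖y - y‖)) := by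
    apply Continuous.tendsto (f := fun x => C * (1 + ‖x‖ ^ k + ‖y‖ ^ k) * ‖x - y‖)
    fun_prop
  rw [sub_self, norm_zero, mul_zero] at h0
  exact squeeze_zero (fun _ => dist_nonneg) (fun x => hC x y) h0

theorem abs_rpow_sub_le {p : ℝ} (hp : 1 ≤ p) (k : ℕ) (hk : p ≤ k) {a b : ℝ} (ha : 0 ≤ a)
    (hb : 0 ≤ b) : |a ^ p - b ^ p| ≤ p * (1 + a + b) ^ k * |a - b| := by
  wlog hab : b ≤ a generalizing a b
  · have := this hb ha (le_of_not_ge hab)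
    rw [abs_sub_comm, abs_sub_comm a b]
    rwa [show 1 + a + b = 1 + b + a by ring]
  rcases ha.eq_or_lt with rfl | ha'
  · obtain rfl : b = 0 := le_antisymm hab hb
    simp
  have h1 := one_add_mul_self_le_rpow_one_add (s := b / a - 1)
    (by linarith [div_nonneg hb ha]) hp
  rw [show 1 + (b / a - 1) = b / a by ring, Real.div_rpow hb ha,
    le_div_iff₀ (Real.rpow_pos_of_pos ha' p)] at h1
  have hap : a ^ p = a ^ (p - 1) * a := by
    rw [← Real.rpow_add_one ha'.ne']; ring_nf
  have h2 : a ^ p - b ^ p ≤ p * a ^ (p - 1) * (a - b) := by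
    have : (1 + p * (b / a - 1)) * a ^ p = a ^ p - p * a ^ (p - 1) * (a - b) := by
      rw [hap]; field_simp; ring
    linarith
  have h3 : a ^ (p - 1) ≤ (1 + a + b) ^ k := by
    rw [← Real.rpow_natCast]
    calc a ^ (p - 1) ≤ (1 + a + b) ^ (p - 1) :=
          Real.rpow_le_rpow ha (by linarith) (by linarith)
      _ ≤ _ := Real.rpow_le_rpow_of_exponent_le (by linarith) (by linarith)
  rw [abs_of_nonneg (sub_nonneg.2 (Real.rpow_le_rpow hb hab (by linarith))),
    abs_of_nonneg (sub_nonneg.2 hab)]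
  refine h2.trans ?_
  gcongr

theorem LocLip.abs_rpow {n : ℕ} {φ : (Fin n → ℝ) → ℝ} (h : LocLip φ) {p : ℝ} (hp : 1 ≤ p) :
    LocLip (fun x => |φ x| ^ p) := by
  obtain ⟨C, k, hC0, hC⟩ := h.exists_pos
  obtain ⟨j, hj⟩ := exists_nat_ge p
  set D : ℝ := 1 + 2 * |φ 0| + 2 * C
  have hD : 0 ≤ D := by positivity
  have hbd : ∀ x, |φ x| ≤ |φ 0| + C * (1 + ‖x‖) ^ (k + 1) := by
    intro x
    have h1 := hC x 0
    rw [norm_zero, add_zero, sub_zero] at h1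
    have h2 : |φ x| ≤ |φ 0| + |φ x - φ 0| := by
      have := abs_add_le (φ 0) (φ x - φ 0)
      rwa [add_sub_cancel] at this
    have h3 : C * (1 + ‖x‖) ^ k * ‖x‖ ≤ C * (1 + ‖x‖) ^ (k + 1) := by
      rw [pow_succ, mul_assoc]
      gcongr
      linarith
    linarith
  refine LocLip.of_pow (p * D ^ j * C) ((k + 1) * j + k) (by positivity) fun x y => ?_
  have hR : 1 ≤ 1 + ‖x‖ + ‖y‖ := by linarith [norm_nonneg x, norm_nonneg y]
  set R := 1 + ‖x‖ + ‖y‖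
  have hRk : 1 ≤ R ^ (k + 1) := one_le_pow₀ hR
  have hx : |φ x| ≤ |φ 0| + C * R ^ (k + 1) := (hbd x).trans (by
    gcongr; simp only [R]; linarith [norm_nonneg y])
  have hy : |φ y| ≤ |φ 0| + C * R ^ (k + 1) := (hbd y).trans (by
    gcongr; simp only [R]; linarith [norm_nonneg x])
  have hs : 1 + |φ x| + |φ y| ≤ D * R ^ (k + 1) := by
    have : 1 + 2 * |φ 0| ≤ (1 + 2 * |φ 0|) * R ^ (k + 1) :=
      le_mul_of_one_le_right (by positivity) hRk
    simp only [D]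
    nlinarith
  calc |(|φ x| ^ p - |φ y| ^ p)|
      ≤ p * (1 + |φ x| + |φ y|) ^ j * |(|φ x| - |φ y|)| :=
        abs_rpow_sub_le hp j hj (abs_nonneg _) (abs_nonneg _)
    _ ≤ p * (D * R ^ (k + 1)) ^ j * (C * R ^ k * ‖x - y‖) := by
        gcongr
        exact (abs_abs_sub_abs_le _ _).trans (hC x y)
    _ = _ := by rw [mul_pow, ← pow_mul, pow_add]; ring

theorem LocLip.const (n : ℕ) (c : ℝ) : LocLip (fun _ : Fin n → ℝ => c) :=
  ⟨0, 0, fun x y => by simp⟩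

theorem LocLip.const_mul {n : ℕ} {φ : (Fin n → ℝ) → ℝ} (h : LocLip φ) (c : ℝ) :
    LocLip (fun x => c * φ x) := by
  obtain ⟨C, k, hC0, hC⟩ := h.exists_pos
  refine LocLip.of_pow (|c| * C) k (by positivity) fun x y => ?_
  rw [← mul_sub, abs_mul, mul_assoc, mul_assoc, ← mul_assoc C]
  gcongr
  exact hC x y

theorem norm_castAdd_le {n l : ℕ} (x : Fin (n + l) → ℝ) :
    ‖fun i => x (Fin.castAdd l i)‖ ≤ ‖x‖ :=
  (pi_norm_le_iff_of_nonneg (norm_nonneg _)).2 fun _ => norm_le_pi_norm x _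

theorem norm_natAdd_le {n l : ℕ} (x : Fin (n + l) → ℝ) :
    ‖fun i => x (Fin.natAdd n i)‖ ≤ ‖x‖ :=
  (pi_norm_le_iff_of_nonneg (norm_nonneg _)).2 fun _ => norm_le_pi_norm x _

theorem LocLip.append {n l : ℕ} {φ : (Fin n → ℝ) → ℝ} {ψ : (Fin l → ℝ) → ℝ}
    (h : LocLip φ) (h' : LocLip ψ) :
    LocLip (fun x : Fin (n + l) → ℝ =>
      φ (fun i => x (Fin.castAdd l i)) + ψ (fun i => x (Fin.natAdd n i))) := by
  obtain ⟨C, k, hC0, hC⟩ := h.exists_pos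
  obtain ⟨D, j, hD0, hD⟩ := h'.exists_pos
  refine LocLip.of_pow (C + D) (k + j) (by positivity) fun x y => ?_
  have hR : 1 ≤ 1 + ‖x‖ + ‖y‖ := by linarith [norm_nonneg x, norm_nonneg y]
  have h1 : |φ (fun i => x (Fin.castAdd l i)) - φ (fun i => y (Fin.castAdd l i))| ≤
      C * (1 + ‖x‖ + ‖y‖) ^ (k + j) * ‖x - y‖ := by
    refine (hC _ _).trans ?_
    have := norm_castAdd_le (x - y)
    calc _ ≤ C * (1 + ‖x‖ + ‖y‖) ^ k * ‖x - y‖ := by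
          gcongr
          exacts [norm_castAdd_le x, norm_castAdd_le y, this]
      _ ≤ _ := by gcongr; all_goals linarith
  have h2 : |ψ (fun i => x (Fin.natAdd n i)) - ψ (fun i => y (Fin.natAdd n i))| ≤
      D * (1 + ‖x‖ + ‖y‖) ^ (k + j) * ‖x - y‖ := by
    refine (hD _ _).trans ?_
    have := norm_natAdd_le (x - y)
    calc _ ≤ D * (1 + ‖x‖ + ‖y‖) ^ j * ‖x - y‖ := by
          gcongr
          exacts [norm_natAdd_le x, norm_natAdd_le y, this]
      _ ≤ _ := by gcongr; all_goals linarith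
  rw [add_sub_add_comm]
  refine (abs_add_le _ _).trans ((add_le_add h1 h2).trans (le_of_eq ?_))
  ring

variable {T : ℝ≥0} {X Y : PathSpace T → ℝ}

theorem IsRep.add {n l : ℕ} {t s φ ψ} (hX : IsRep X n t φ) (hY : IsRep Y l s ψ) :
    IsRep (X + Y) (n + l) (Fin.append t s) (fun x : Fin (n + l) → ℝ =>
      φ (fun i => x (Fin.castAdd l i)) + ψ (fun i => x (Fin.natAdd n i))) :=
  ⟨hX.1.append hY.1, fun w => by simp [hX.2, hY.2]⟩

theorem IsRep.smul {n : ℕ} {t φ} (hX : IsRep X n t φ) (c : ℝ) :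
    IsRep (c • X) n t (fun x => c * φ x) :=
  ⟨hX.1.const_mul c, fun w => by simp [hX.2]⟩

theorem IsRep.abs_rpow {n : ℕ} {t φ} (hX : IsRep X n t φ) {p : ℝ} (hp : 1 ≤ p) :
    IsRep (fun w => |X w| ^ p) n t (fun x => |φ x| ^ p) :=
  ⟨hX.1.abs_rpow hp, fun w => by simp [hX.2]⟩

/-- The space `𝒞_T` of cylinder functions. -/
def cyl (T : ℝ≥0) : Submodule ℝ (PathSpace T → ℝ) where
  carrier := {X | IsCylinder X}
  add_mem' := by
    rintro X Y ⟨n, t, φ, h⟩ ⟨l, s, ψ, h'⟩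
    exact ⟨_, _, _, h.add h'⟩
  zero_mem' := ⟨0, Fin.elim0, fun _ => 0, LocLip.const 0 0, fun _ => rfl⟩
  smul_mem' := by
    rintro c X ⟨n, t, φ, h⟩
    exact ⟨_, _, _, h.smul c⟩

/-- The cylinder function `|ξ|^p`. -/
def absPow (p : ℝ) [hp : Fact (1 ≤ p)] (ξ : cyl T) : cyl T :=
  ⟨fun w => |ξ.1 w| ^ p, by
    obtain ⟨n, t, φ, h⟩ := ξ.2
    exact ⟨_, _, _, h.abs_rpow hp.1⟩⟩

/-- A path through finitely many prescribed points. -/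
theorem exists_path (v : Set.Iic T → ℝ) (hv : v ⟨0, Set.mem_Iic.2 zero_le⟩ = 0) (S : Finset (Set.Iic T)) :
    ∃ w : PathSpace T, ∀ t ∈ S, w.1 t = v t := by
  classical
  let S' := insert (⟨0, Set.mem_Iic.2 zero_le⟩ : Set.Iic T) S
  let node : Set.Iic T → ℝ := fun t => ((t : ℝ≥0) : ℝ)
  have hinj : Set.InjOn node S' := fun a _ b _ h => Subtype.ext (NNReal.coe_injective h)
  let q := Lagrange.interpolate S' node v
  have hq : ∀ t ∈ S', q.eval (node t) = v t := fun t ht =>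
    Lagrange.eval_interpolate_at_node v hinj ht
  refine ⟨⟨⟨fun t => q.eval (node t), ?_⟩, ?_⟩, ?_⟩
  · exact q.continuous.comp (NNReal.continuous_coe.comp continuous_subtype_val)
  · exact (hq _ (Finset.mem_insert_self _ _)).trans hv
  · exact fun t ht => hq t (Finset.mem_insert_of_mem ht)

/-- Two representations of a cylinder function agree at all values that vanish at time `0`. -/
theorem IsRep.unique {n l : ℕ} {t s φ ψ} (hX : IsRep X n t φ) (hX' : IsRep X l s ψ)
    (v : Set.Iic T → ℝ) (hv : v ⟨0, Set.mem_Iic.2 zero_le⟩ = 0) :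
    φ (fun i => v (t i)) = ψ (fun i => v (s i)) := by
  classical
  obtain ⟨w, hw⟩ := exists_path v hv (Finset.univ.image t ∪ Finset.univ.image s)
  have h1 : (fun i => v (t i)) = fun i => w.1 (t i) := by
    funext i; rw [hw]; simp
  have h2 : (fun i => v (s i)) = fun i => w.1 (s i) := by
    funext i; rw [hw]; simp
  rw [h1, h2, ← hX.2, ← hX'.2]

end Cylinder

section GSpace

variable {Ω : Type*} [MeasurableSpace Ω] {P : Measure Ω} [P.IsComplete]
  {W : ℝ≥0 → Ω → ℝ} (hW : IsBrownianReal W P) {T : ℝ≥0}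

/-- The random variable `ξ^θ = φ(B_{t_1}^θ, …, B_{t_n}^θ)` for a cylinder function
`ξ = φ(B_{t_1}, …, B_{t_n})`; up to a null set it does not depend on the representation of `ξ`
(see `ev_ae_eq`). -/
def ev (θ : ℝ≥0 → Ω → ℝ) (ξ : cyl T) (ω : Ω) : ℝ :=
  ξ.2.choose_spec.choose_spec.choose fun i => ctrl hW θ (ξ.2.choose_spec.choose i : ℝ≥0) ω

theorem ev_ae_eq (θ : ℝ≥0 → Ω → ℝ) (ξ : cyl T) {n : ℕ} {t : Fin n → Set.Iic T}
    {φ : (Fin n → ℝ) → ℝ} (h : IsRep ξ.1 n t φ) :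
    ev hW θ ξ =ᵐ[P] fun ω => φ fun i => ctrl hW θ (t i : ℝ≥0) ω := by
  filter_upwards [ctrl_zero hW θ] with ω hω
  exact ξ.2.choose_spec.choose_spec.choose_spec.unique h
    (fun t => ctrl hW θ (t : ℝ≥0) ω) hω

theorem aestronglyMeasurable_ev (θ : ℝ≥0 → Ω → ℝ) (ξ : cyl T) :
    AEStronglyMeasurable (ev hW θ ξ) P := by
  refine ξ.2.choose_spec.choose_spec.choose_spec.1.continuous.comp_aestronglyMeasurable ?_
  refine AEMeasurable.aestronglyMeasurable (aemeasurable_pi_lambda _ fun i => ?_)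
  exact (Lp.aestronglyMeasurable _).aemeasurable

theorem ev_add (θ : ℝ≥0 → Ω → ℝ) (ξ η : cyl T) :
    ev hW θ (ξ + η) =ᵐ[P] ev hW θ ξ + ev hW θ η := by
  obtain ⟨n, t, φ, h⟩ := ξ.2
  obtain ⟨l, s, ψ, h'⟩ := η.2
  filter_upwards [ev_ae_eq hW θ ξ h, ev_ae_eq hW θ η h', ev_ae_eq hW θ (ξ + η) (h.add h')]
    with ω h1 h2 h3
  rw [Pi.add_apply, h1, h2, h3]
  simp

theorem ev_smul (θ : ℝ≥0 → Ω → ℝ) (c : ℝ) (ξ : cyl T) :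
    ev hW θ (c • ξ) =ᵐ[P] c • ev hW θ ξ := by
  obtain ⟨n, t, φ, h⟩ := ξ.2
  filter_upwards [ev_ae_eq hW θ ξ h, ev_ae_eq hW θ (c • ξ) (h.smul c)] with ω h1 h3
  rw [Pi.smul_apply, h1, h3]
  simp

theorem ev_absPow (θ : ℝ≥0 → Ω → ℝ) (p : ℝ) [hp : Fact (1 ≤ p)] (ξ : cyl T) :
    ev hW θ (absPow p ξ) =ᵐ[P] fun ω => |ev hW θ ξ ω| ^ p := by
  obtain ⟨n, t, φ, h⟩ := ξ.2
  filter_upwards [ev_ae_eq hW θ ξ h, ev_ae_eq hW θ (absPow p ξ) (h.abs_rpow hp.1)] with ω h1 h3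
  rw [h1, h3]

/-- The `G`-expectation `Ê[ξ] = sup_θ E_P[ξ^θ] ∈ [0, ∞]` of a nonnegative cylinder function. -/
def gExp (Θ : Set ℝ) (ξ : cyl T) : ℝ≥0∞ :=
  ⨆ θ : admissible hW Θ, ∫⁻ ω, ENNReal.ofReal (ev hW θ.1 ξ ω) ∂P

variable (Θ : Set ℝ) (p : ℝ) [hp : Fact (1 ≤ p)]

/-- `Ê[|ξ|^p]^{1/p}` as an element of `[0, ∞]`. -/
def eNorm (ξ : cyl T) : ℝ≥0∞ := (gExp hW Θ (absPow p ξ)) ^ (1 / p)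

theorem eLpNorm_ev (θ : ℝ≥0 → Ω → ℝ) (ξ : cyl T) :
    eLpNorm (ev hW θ ξ) (ENNReal.ofReal p) P =
      (∫⁻ ω, ENNReal.ofReal (ev hW θ (absPow p ξ) ω) ∂P) ^ (1 / p) := by
  have hp0 : 0 < p := zero_lt_one.trans_le hp.1
  rw [eLpNorm_eq_lintegral_rpow_enorm_toReal (by simpa using hp0) ENNReal.ofReal_ne_top,
    ENNReal.toReal_ofReal hp0.le]
  congr 1
  refine lintegral_congr_ae ?_
  filter_upwards [ev_absPow hW θ p ξ] with ω h
  rw [h, ← ENNReal.ofReal_rpow_of_nonneg (abs_nonneg _) hp0.le, ← Real.norm_eq_abs, ofReal_norm]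

theorem eNorm_eq (ξ : cyl T) :
    eNorm hW Θ p ξ =
      ⨆ θ : admissible hW Θ, eLpNorm (ev hW θ.1 ξ) (ENNReal.ofReal p) P := by
  have hp0 : 0 < p := zero_lt_one.trans_le hp.1
  simp only [eLpNorm_ev, eNorm, gExp]
  exact (ENNReal.orderIsoRpow (1 / p) (by positivity)).map_iSup _

theorem eNorm_add_le (ξ η : cyl T) :
    eNorm hW Θ p (ξ + η) ≤ eNorm hW Θ p ξ + eNorm hW Θ p η := by
  simp only [eNorm_eq]
  refine iSup_le fun θ => ?_
  rw [eLpNorm_congr_ae (ev_add hW θ.1 ξ η)]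
  refine (eLpNorm_add_le (aestronglyMeasurable_ev hW θ.1 ξ) (aestronglyMeasurable_ev hW θ.1 η)
    (by simpa using hp.1)).trans (add_le_add ?_ ?_)
  · exact le_iSup (fun θ : admissible hW Θ => eLpNorm (ev hW θ.1 ξ) (ENNReal.ofReal p) P) θ
  · exact le_iSup (fun θ : admissible hW Θ => eLpNorm (ev hW θ.1 η) (ENNReal.ofReal p) P) θ

theorem eNorm_smul_le (c : ℝ) (ξ : cyl T) :
    eNorm hW Θ p (c • ξ) ≤ ‖c‖ₑ * eNorm hW Θ p ξ := by
  simp only [eNorm_eq]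
  refine iSup_le fun θ => ?_
  rw [eLpNorm_congr_ae (ev_smul hW θ.1 c ξ), eLpNorm_const_smul]
  gcongr
  exact le_iSup (fun θ : admissible hW Θ => eLpNorm (ev hW θ.1 ξ) (ENNReal.ofReal p) P) θ

theorem eNorm_zero : eNorm hW Θ p (0 : cyl T) = 0 := by
  have := eNorm_smul_le hW Θ p 0 (0 : cyl T)
  simpa using this

/-- The cylinder functions with `Ê[|ξ|^p]^{1/p} < ∞`. When `Θ` is bounded these are all cylinder
functions, since then all moments of `B_t^θ` are bounded uniformly in `θ` and `φ` has polynomial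
growth. -/
def cylLpSub : Submodule ℝ (cyl T) where
  carrier := {ξ | eNorm hW Θ p ξ < ∞}
  add_mem' {ξ η} h h' := (eNorm_add_le hW Θ p ξ η).trans_lt (ENNReal.add_lt_top.2 ⟨h, h'⟩)
  zero_mem' := by simp [eNorm_zero]
  smul_mem' c ξ h := (eNorm_smul_le hW Θ p c ξ).trans_lt (ENNReal.mul_lt_top (by simp) h)

variable (T) in
/-- The space of cylinder functions with the norm of `L_G^p`. -/
def CylLp : Type := cylLpSub hW Θ p (T := T)

instance : AddCommGroup (CylLp hW T Θ p) :=
  inferInstanceAs (AddCommGroup (cylLpSub hW Θ p (T := T)))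

/-- The underlying cylinder function. -/
def CylLp.toCyl {hW : IsBrownianReal W P} {Θ : Set ℝ} {p : ℝ} [Fact (1 ≤ p)]
    (ξ : CylLp hW T Θ p) : cyl T :=
  Subtype.val (p := (· ∈ cylLpSub hW Θ p (T := T))) ξ

theorem CylLp.toCyl_add (ξ η : CylLp hW T Θ p) : (ξ + η).toCyl = ξ.toCyl + η.toCyl := rfl

theorem CylLp.eNorm_lt_top (ξ : CylLp hW T Θ p) : eNorm hW Θ p ξ.toCyl < ∞ :=
  Subtype.prop (p := (· ∈ cylLpSub hW Θ p (T := T))) ξ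

/-- The seminorm `‖ξ‖ = Ê[|ξ|^p]^{1/p}`. -/
def gSeminorm : AddGroupSeminorm (CylLp hW T Θ p) where
  toFun ξ := ((gExp hW Θ (absPow p ξ.toCyl)) ^ (1 / p)).toReal
  map_zero' := by
    change (eNorm hW Θ p (0 : cyl T)).toReal = 0
    rw [eNorm_zero, ENNReal.toReal_zero]
  add_le' ξ η := by
    change (eNorm hW Θ p (ξ + η).toCyl).toReal ≤
      (eNorm hW Θ p ξ.toCyl).toReal + (eNorm hW Θ p η.toCyl).toReal
    rw [← ENNReal.toReal_add (CylLp.eNorm_lt_top hW Θ p ξ).ne (CylLp.eNorm_lt_top hW Θ p η).ne]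
    refine ENNReal.toReal_mono ?_ (eNorm_add_le hW Θ p _ _)
    exact (ENNReal.add_lt_top.2
      ⟨CylLp.eNorm_lt_top hW Θ p ξ, CylLp.eNorm_lt_top hW Θ p η⟩).ne
  neg' ξ := by
    change (eNorm hW Θ p (-ξ.toCyl)).toReal = (eNorm hW Θ p ξ.toCyl).toReal
    have key : ∀ ζ : cyl T, eNorm hW Θ p (-ζ) ≤ eNorm hW Θ p ζ := fun ζ => by
      have h := eNorm_smul_le hW Θ p (-1) ζ
      have h1 : (-1 : ℝ) • ζ = -ζ := by ext w; simp
      rw [h1] at h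
      simpa using h
    congr 1
    refine le_antisymm (key _) ?_
    simpa using key (-ξ.toCyl)

instance : SeminormedAddCommGroup (CylLp hW T Θ p) :=
  (gSeminorm hW Θ p).toSeminormedAddCommGroup

variable (T) in
/-- The `G`-expectation space `L_G^p(Ω_T)`: the completion of the space of cylinder functions
under the norm `Ê[|ξ|^p]^{1/p}`. -/
abbrev LG : Type := UniformSpace.Completion (CylLp hW T Θ p)

theorem memLp_ev (θ : admissible hW Θ) (ξ : CylLp hW T Θ p) :
    MemLp (ev hW θ.1 ξ.toCyl) (ENNReal.ofReal p) P := by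
  refine ⟨aestronglyMeasurable_ev hW θ.1 _, lt_of_le_of_lt ?_ (CylLp.eNorm_lt_top hW Θ p ξ)⟩
  rw [eNorm_eq]
  exact le_iSup (fun θ : admissible hW Θ =>
    eLpNorm (ev hW θ.1 ξ.toCyl) (ENNReal.ofReal p) P) θ

variable {hW Θ p}

/-- `Φ` on cylinder functions: `Φ(ξ) = {ξ^θ}_θ`, a family in `L^p(P)` indexed by the admissible
controls. -/
def phiCyl (ξ : CylLp hW T Θ p) (θ : admissible hW Θ) : Lp ℝ (ENNReal.ofReal p) P :=
  (memLp_ev hW Θ p θ ξ).toLp _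

/-- `F = Φ(X)`: whenever cylinder functions `ξ_n` converge to `X` in `L_G^p`, then
`sup_θ ‖F^θ - ξ_n^θ‖_{L^p(P)} → 0`. -/
def IsPhi (X : LG hW T Θ p) (F : admissible hW Θ → Lp ℝ (ENNReal.ofReal p) P) : Prop :=
  ∀ ξ : ℕ → CylLp hW T Θ p,
    Tendsto (fun n => ‖X - (ξ n : LG hW T Θ p)‖) atTop (𝓝 0) →
    Tendsto (fun n => ⨆ θ, ‖F θ - phiCyl (ξ n) θ‖ₑ) atTop (𝓝 0)

/-- The map `Φ` from `L_G^p(Ω_T)` to families `{X^θ}_θ` in `L^p(P)`: `Φ(X)` is the (unique) family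
that is the limit of `Φ(ξ_n)`, uniformly in `θ`, for cylinder functions `ξ_n → X`. -/
def Phi (X : LG hW T Θ p) : admissible hW Θ → Lp ℝ (ENNReal.ofReal p) P :=
  Classical.epsilon (IsPhi X)

end GSpace

end GHom

end

noncomputable section

namespace GHom

section PhiExtension

variable {Ω : Type*} [MeasurableSpace Ω] {P : Measure Ω} [P.IsComplete]
  {W : ℝ≥0 → Ω → ℝ} {hW : IsBrownianReal W P} {T : ℝ≥0} {Θ : Set ℝ} {p : ℝ}
  [hp : Fact (1 ≤ p)]

/-! `Phi X` is picked by `Classical.epsilon` from the families satisfying `IsPhi X`, so nothing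
about it is usable until such a family is known to exist and to be unique. For fixed `θ`, evaluation
`ξ ↦ ξ^θ` is additive on cylinder functions, and it is a contraction into `L^p(P)` because the
`G`-norm is the supremum over `θ` of the `L^p(P)` norms. It therefore extends to an additive
contraction `phiHom θ` on the completion. The Lipschitz constant is the same for all `θ`, so the
family of extensions satisfies `IsPhi X` (`isPhi_phiHom`). Density of cylinder functions and
uniqueness of limits in `L^p(P)` exclude any other family (`IsPhi.unique`). Hence `Phi X θ = phiHom
θ X`, which is additive in `X`. -/

theorem fact_one_le_ofReal (p : ℝ) [hp : Fact (1 ≤ p)] : Fact (1 ≤ ENNReal.ofReal p) :=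
  ⟨by simpa using hp.1⟩

-- The condition `1 ≤ p` makes `Lp ℝ (ENNReal.ofReal p) P` a complete normed group, as the extension
-- requires.
attribute [local instance] fact_one_le_ofReal

theorem CylLp.norm_eq (ξ : CylLp hW T Θ p) : ‖ξ‖ = (eNorm hW Θ p ξ.toCyl).toReal := rfl

/-- `ev` goes through a chosen representation of the cylinder function, so it is shown to be
additive only almost surely; on classes in `L^p(P)` this becomes an equality. -/
theorem phiCyl_add (ξ η : CylLp hW T Θ p) (θ : admissible hW Θ) :
    phiCyl (ξ + η) θ = phiCyl ξ θ + phiCyl η θ := by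
  unfold phiCyl
  rw [← MemLp.toLp_add, MemLp.toLp_eq_toLp_iff]
  exact ev_add hW θ.1 ξ.toCyl η.toCyl

/-- The left side is one term of the supremum on the right. That supremum is finite on `CylLp`, so
`toReal` preserves the inequality. -/
theorem norm_phiCyl_le (ξ : CylLp hW T Θ p) (θ : admissible hW Θ) :
    ‖phiCyl ξ θ‖ ≤ ‖ξ‖ := by
  rw [CylLp.norm_eq, phiCyl, Lp.norm_toLp]
  refine ENNReal.toReal_mono (CylLp.eNorm_lt_top hW Θ p ξ).ne ?_
  rw [eNorm_eq]
  exact le_iSup (fun θ : admissible hW Θ =>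
    eLpNorm (ev hW θ.1 ξ.toCyl) (ENNReal.ofReal p) P) θ

/-- Evaluation `ξ ↦ ξ^θ` of cylinder functions, as a contraction into `L^p(P)`. -/
def phiCylHom (θ : admissible hW Θ) :
    NormedAddGroupHom (CylLp hW T Θ p) (Lp ℝ (ENNReal.ofReal p) P) :=
  (AddMonoidHom.mk' (fun ξ => phiCyl ξ θ) fun ξ η =>
    phiCyl_add ξ η θ).mkNormedAddGroupHom 1 fun ξ => by
      simpa using norm_phiCyl_le ξ θ

/-- The contraction `X ↦ X^θ` from `L_G^p(Ω_T)` to `L^p(P)` that extends evaluation of cylinder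
functions. -/
def phiHom (θ : admissible hW Θ) :
    NormedAddGroupHom (LG hW T Θ p) (Lp ℝ (ENNReal.ofReal p) P) :=
  (phiCylHom θ).extension

theorem phiHom_coe (θ : admissible hW Θ) (ξ : CylLp hW T Θ p) :
    phiHom θ (ξ : LG hW T Θ p) = phiCyl ξ θ :=
  NormedAddGroupHom.extension_coe _ ξ

/-- The inequality is a closed condition on `X`, so it passes from the dense cylinder functions to
the completion. -/
theorem norm_phiHom_le (θ : admissible hW Θ) (X : LG hW T Θ p) : ‖phiHom θ X‖ ≤ ‖X‖ := by
  induction X using UniformSpace.Completion.induction_on with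
  | hp => exact isClosed_le (phiHom θ).continuous.norm continuous_norm
  | ih ξ =>
    rw [phiHom_coe, UniformSpace.Completion.norm_coe]
    exact norm_phiCyl_le ξ θ

/-- Existence: the bound by `‖X - ξ n‖` does not involve `θ`, so it survives the supremum. -/
theorem isPhi_phiHom (X : LG hW T Θ p) : IsPhi X fun θ => phiHom θ X := by
  intro ξ hξ
  have h : Tendsto (fun n => ENNReal.ofReal ‖X - (ξ n : LG hW T Θ p)‖) atTop (𝓝 0) := by
    simpa using ENNReal.tendsto_ofReal hξ
  refine tendsto_of_tendsto_of_tendsto_of_le_of_le tendsto_const_nhds h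
    (fun _ => zero_le) fun n => iSup_le fun θ => ?_
  -- Additivity turns the difference of values into the value of `phiHom θ` at `X - ξ n`.
  rw [← phiHom_coe, ← map_sub, ← ofReal_norm]
  exact ENNReal.ofReal_le_ofReal (norm_phiHom_le θ _)

/-- Without an approximating sequence `IsPhi X` would hold vacuously for every family and could not
determine `Phi X`. -/
theorem exists_cylLp_tendsto (X : LG hW T Θ p) :
    ∃ ξ : ℕ → CylLp hW T Θ p,
      Tendsto (fun n => ‖X - (ξ n : LG hW T Θ p)‖) atTop (𝓝 0) := by
  obtain ⟨u, hu, hlim⟩ := mem_closure_iff_seq_limit.1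
    ((UniformSpace.Completion.denseRange_coe (α := CylLp hW T Θ p)) X)
  choose ξ hξ using hu
  refine ⟨ξ, ?_⟩
  simp only [hξ, norm_sub_rev X]
  exact tendsto_iff_norm_sub_tendsto_zero.1 hlim

/-- Along one approximating sequence, uniform convergence gives convergence for each `θ`, and
`L^p(P)` is Hausdorff. -/
theorem IsPhi.unique {X : LG hW T Θ p}
    {F G : admissible hW Θ → Lp ℝ (ENNReal.ofReal p) P} (hF : IsPhi X F) (hG : IsPhi X G) :
    F = G := by
  obtain ⟨ξ, hξ⟩ := exists_cylLp_tendsto X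
  have key : ∀ {H : admissible hW Θ → Lp ℝ (ENNReal.ofReal p) P}, IsPhi X H →
      ∀ θ, Tendsto (fun n => phiCyl (ξ n) θ) atTop (𝓝 (H θ)) := by
    intro H hH θ
    rw [tendsto_iff_edist_tendsto_0]
    refine tendsto_of_tendsto_of_tendsto_of_le_of_le tendsto_const_nhds (hH ξ hξ)
      (fun _ => zero_le) fun n => ?_
    dsimp only
    rw [edist_comm, edist_eq_enorm_sub]
    exact le_iSup (fun θ => ‖H θ - phiCyl (ξ n) θ‖ₑ) θ
  exact funext fun θ => tendsto_nhds_unique (key hF θ) (key hG θ)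

/-- Existence makes the `epsilon` choice satisfy `IsPhi X`; uniqueness then identifies it. -/
theorem Phi_eq_phiHom (X : LG hW T Θ p) : Phi X = fun θ => phiHom θ X :=
  (Classical.epsilon_spec (p := IsPhi X) ⟨_, isPhi_phiHom X⟩).unique (isPhi_phiHom X)

end PhiExtension

end GHom

end

theorem mainTheorem2 {Ω : Type*} [MeasurableSpace Ω] (P : MeasureTheory.Measure Ω)
    [MeasureTheory.IsProbabilityMeasure P] [P.IsComplete]
    (W : ℝ≥0 → Ω → ℝ) (hW : ProbabilityTheory.IsBrownianReal W P)
    (Θ : Set ℝ) (hΘ : IsCompact Θ) (hΘc : Convex ℝ Θ)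
    (T : ℝ≥0) (p : ℝ) [Fact (1 ≤ p)] (X Y : GHom.LG hW T Θ p) :
    GHom.Phi (X + Y) = GHom.Phi X + GHom.Phi Y := by
  funext θ
  simp only [GHom.Phi_eq_phiHom, Pi.add_apply, map_add]
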